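/- Fix differential feature vectors $x_1,\dots,x_n\in\mathbb{R}^d$ with sample covariance $\Sigma_{\mathcal D}=\frac1n\sum_{i=1}^n x_ix_i^\top$. In the Bradley–Terry–Luce (BTL) model with parameter $\theta\in\mathbb{R}^d$, the labels $y_1,\dots,y_n\in\{0,1\}$ are independent with $\mathbb{P}_\theta[y_i=1]=\sigma(x_i^\top\theta)$, where $\sigma(z)=1/(1+e^{-z})$. For $B>0$ let $\Theta_B=\{\theta\in\mathbb{R}^d:\langle\mathbf 1,\theta\rangle=0,\ \|\theta\|_2\le B\}$, and for a positive semidefinite matrix $A$ write $\|v\|_A^2=v^\top Av$. A randomized estimator $\hat\theta=\hat\theta(y_1,\dots,y_n)\in\mathbb{R}^d$ (which may depend arbitrarily on the public features) is $(\epsilon,0)$-label differentially private in the central model if $\mathbb{P}[\hat\theta(y)\in S]\le e^{\epsilon}\,\mathbb{P}[\hat\theta(y')\in S]$ for every measurable $S\subseteq\mathbb{R}^d$ and all label vectors $y,y'\in\{0,1\}^n$ that differ in exactly one coordinate. **Theorem.** There are absolute constants $c,C>0$ such that the following holds for all $d\ge 2$, $B>0$, $\lambda>0$, $\epsilon>0$,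 all $n$ large enough, in the sense that $$n\ \ge\ \frac{C\,d}{\lambda B^2}\qquad\text{and}\qquad n\ \ge\ \frac{C\,d}{\epsilon B\sqrt{\lambda}},$$ and all $x_1,\dots,x_n\in\mathbb{R}^d$. For every estimator $\hat\theta$ that is $(\epsilon,0)$-label differentially private in the central model there is $\theta^*\in\Theta_B$ such that, when the labels are drawn from the BTL model with parameter $\theta^*$, $$\mathbb{E}\left[\|\hat\theta-\theta^*\|^2_{\Sigma_{\mathcal D}+\lambda I}\right]\ \ge\ c\left(\frac{d}{n}+\frac{d^2}{n^2\epsilon^2}\right),$$ where the expectation (possibly $+\infty$) is over the labels and the randomness of $\hat\theta$. -/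

import Mathlib

open MeasureTheory ProbabilityTheory

noncomputable section

/-- Joint law of the labels `y₁, …, yₙ` in the Bradley-Terry-Luce model with fixed differential
features `x₁, …, xₙ` and reward parameter `θ`: the labels are independent, and `yᵢ = 1` (here
`true`) with probability `σ(xᵢᵀ θ)`, where `σ(z) = 1 / (1 + exp (-z))`. -/
def btlLaw {n d : ℕ} (x : Fin n → EuclideanSpace ℝ (Fin d)) (θ : EuclideanSpace ℝ (Fin d)) :
    Measure (Fin n → Bool) :=
  Measure.pi fun i => bernoulliMeasure true false (unitInterval.sigmoid (inner ℝ (x i) θ))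

/-- The parameter set `Θ_B = {θ ∈ ℝᵈ | ⟨𝟏, θ⟩ = 0, ‖θ‖ ≤ B}`. -/
def paramSet (d : ℕ) (B : ℝ) : Set (EuclideanSpace ℝ (Fin d)) :=
  {θ | ∑ j, θ j = 0 ∧ ‖θ‖ ≤ B}

/-- The sample covariance matrix `Σ_D = (1/n) ∑ᵢ xᵢ xᵢᵀ`. -/
def sampleCov {n d : ℕ} (x : Fin n → EuclideanSpace ℝ (Fin d)) : Matrix (Fin d) (Fin d) ℝ :=
  (1 / (n : ℝ)) • ∑ i, Matrix.vecMulVec (x i).ofLp (x i).ofLp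

/-- The squared semi-norm `‖v‖²_A = vᵀ A v`. -/
def sqSemiNorm {d : ℕ} (A : Matrix (Fin d) (Fin d) ℝ) (v : EuclideanSpace ℝ (Fin d)) : ℝ :=
  v.ofLp ⬝ᵥ (A.mulVec v.ofLp)

/-- `(ε, δ)`-label differential privacy in the central model, for a fixed (public) design: `M y` is
the law of the output of the randomized algorithm `M` on the label vector `y`, and two data sets
are neighbours when they differ in the label of exactly one sample. -/
def IsCentralLabelDP {n : ℕ} {Ω : Type*} [MeasurableSpace Ω] (ε δ : ℝ)
    (M : Kernel (Fin n → Bool) Ω) : Prop :=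
  ∀ y y' : Fin n → Bool, hammingDist y y' = 1 → ∀ S : Set Ω, MeasurableSet S →
    M y S ≤ ENNReal.ofReal (Real.exp ε) * M y' S + ENNReal.ofReal δ

/-- Expected squared error `E ‖θhat - θ‖²_{Σ_D + lam I}` of the randomized estimator `M`, over the
labels drawn from the BTL model with parameter `θ` and over the randomness of `M`; it is an
extended nonnegative real, so it is infinite when the expectation diverges. -/
def semiNormRisk {n d : ℕ} (x : Fin n → EuclideanSpace ℝ (Fin d)) (lam : ℝ)
    (M : Kernel (Fin n → Bool) (EuclideanSpace ℝ (Fin d))) (θ : EuclideanSpace ℝ (Fin d)) :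
    ENNReal :=
  ∫⁻ y, ∫⁻ t, ENNReal.ofReal
    (sqSemiNorm (sampleCov x + lam • (1 : Matrix (Fin d) (Fin d) ℝ)) (t - θ)) ∂(M y) ∂(btlLaw x θ)

end

/-! The parameters are tested against θ = 0, where the labels are uniform. Write ‖·‖ for the norm of
Σ_D + lam I. In the centred subspace, of dimension at least d - 1, the ball ‖θ‖ ≤ R contains
16^(d-1) points at mutual distance at least R/16. If the risk were below (R/32)²/2 at each of them,
the estimator would hit the ball of radius R/32 around each point with probability at least 1/2
under that point's own law.

Passing to the uniform law costs a controlled factor. A second-moment bound (`sq_bernoulliExp_le`)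
costs exp(∑(2pᵢ - 1)²) ≤ exp(nR²); privacy (`bernoulliExp_le_of_hammingDist`) costs exp(ε∑|2pᵢ - 1|)
≤ exp(εnR). If either exponent is at most d - 1, every ball keeps uniform mass at least
e^(-(d-1))/4. The balls are disjoint and 16^(d-1) > 4e^(d-1), a contradiction (`exists_risk_ge`).
The larger admissible R gives the rate. -/

/-! ### Product Bernoulli laws and change of measure to the uniform law. -/

/-- Expectation of `f` under the product of the Bernoulli distributions with parameters `p i`. -/
noncomputable def bernoulliExp {n : ℕ} (p : Fin n → ℝ) (f : (Fin n → Bool) → ℝ) : ℝ :=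
  ∑ y, (∏ i, if y i then p i else 1 - p i) * f y

theorem bernoulliExp_succ {n : ℕ} (p : Fin (n + 1) → ℝ) (f : (Fin (n + 1) → Bool) → ℝ) :
    bernoulliExp p f =
      p 0 * bernoulliExp (fun i => p i.succ) (fun y => f (Fin.cons true y)) +
      (1 - p 0) * bernoulliExp (fun i => p i.succ) (fun y => f (Fin.cons false y)) := by
  unfold bernoulliExp
  rw [← (Fin.consEquiv (fun _ : Fin (n + 1) => Bool)).sum_comp, Fintype.sum_prod_type,
    Fintype.sum_bool, Finset.mul_sum, Finset.mul_sum]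
  simp [Fin.consEquiv, Fin.prod_univ_succ, mul_assoc]

theorem bernoulliExp_mono {n : ℕ} {p : Fin n → ℝ} (hp : ∀ i, p i ∈ Set.Icc (0 : ℝ) 1)
    {f g : (Fin n → Bool) → ℝ} (hfg : ∀ y, f y ≤ g y) : bernoulliExp p f ≤ bernoulliExp p g := by
  unfold bernoulliExp
  refine Finset.sum_le_sum fun y _ => mul_le_mul_of_nonneg_left (hfg y) ?_
  refine Finset.prod_nonneg fun i _ => ?_
  have h := hp i
  split_ifs <;> linarith [h.1, h.2]

theorem bernoulliExp_const_mul {n : ℕ} (p : Fin n → ℝ) (a : ℝ) (f : (Fin n → Bool) → ℝ) :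
    bernoulliExp p (fun y => a * f y) = a * bernoulliExp p f := by
  unfold bernoulliExp
  rw [Finset.mul_sum]
  exact Finset.sum_congr rfl fun y _ => by ring

theorem bernoulliExp_sum {n : ℕ} {ι : Type*} [Fintype ι] (p : Fin n → ℝ)
    (f : ι → (Fin n → Bool) → ℝ) :
    ∑ j, bernoulliExp p (f j) = bernoulliExp p (fun y => ∑ j, f j y) := by
  unfold bernoulliExp
  rw [Finset.sum_comm]
  simp_rw [Finset.mul_sum]

theorem bernoulliExp_one {n : ℕ} (p : Fin n → ℝ) : bernoulliExp p (fun _ => 1) = 1 := by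
  induction n with
  | zero => simp [bernoulliExp]
  | succ n ih => rw [bernoulliExp_succ, ih]; ring

theorem bernoulliExp_nonneg {n : ℕ} {p : Fin n → ℝ} (hp : ∀ i, p i ∈ Set.Icc (0 : ℝ) 1)
    {f : (Fin n → Bool) → ℝ} (hf : ∀ y, 0 ≤ f y) : 0 ≤ bernoulliExp p f := by
  have h := bernoulliExp_mono hp (f := fun y => 0 * f y) (g := f) (by simpa using hf)
  rwa [bernoulliExp_const_mul, zero_mul] at h

theorem half_mem_Icc : (1 / 2 : ℝ) ∈ Set.Icc (0 : ℝ) 1 := by constructor <;> norm_num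

/-- Second-moment change of measure from a product of Bernoulli laws to the uniform law. -/
theorem sq_bernoulliExp_le {n : ℕ} {p : Fin n → ℝ} (f : (Fin n → Bool) → ℝ) :
    bernoulliExp p f ^ 2 ≤
      Real.exp (∑ i, (2 * p i - 1) ^ 2) * bernoulliExp (fun _ => 1 / 2) (fun y => f y ^ 2) := by
  induction n with
  | zero => simp [bernoulliExp]
  | succ n ih =>
    rw [bernoulliExp_succ, bernoulliExp_succ, Fin.sum_univ_succ, Real.exp_add]
    have h1 := ih (p := fun i => p i.succ) fun y => f (Fin.cons true y)
    have h2 := ih (p := fun i => p i.succ) fun y => f (Fin.cons false y)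
    set a := bernoulliExp (fun i => p i.succ) fun y => f (Fin.cons true y)
    set b := bernoulliExp (fun i => p i.succ) fun y => f (Fin.cons false y)
    set a' := bernoulliExp (fun _ : Fin n => (1 / 2 : ℝ)) fun y => f (Fin.cons true y) ^ 2
    set b' := bernoulliExp (fun _ : Fin n => (1 / 2 : ℝ)) fun y => f (Fin.cons false y) ^ 2
    set K := Real.exp (∑ i : Fin n, (2 * p i.succ - 1) ^ 2)
    have h3 : 1 + (2 * p 0 - 1) ^ 2 ≤ Real.exp ((2 * p 0 - 1) ^ 2) := by
      linarith [Real.add_one_le_exp ((2 * p 0 - 1) ^ 2)]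
    have h4 : 0 ≤ K * a' + K * b' := by nlinarith [sq_nonneg a, sq_nonneg b]
    -- Cauchy-Schwarz in the first coordinate; p² + (1 - p)² = (1 + (2p - 1)²)/2 yields one factor
    -- of the exponential.
    calc (p 0 * a + (1 - p 0) * b) ^ 2
        ≤ (p 0 ^ 2 + (1 - p 0) ^ 2) * (a ^ 2 + b ^ 2) := by
          nlinarith [sq_nonneg (p 0 * b - (1 - p 0) * a)]
      _ ≤ (p 0 ^ 2 + (1 - p 0) ^ 2) * (K * a' + K * b') := by gcongr
      _ = (1 + (2 * p 0 - 1) ^ 2) * ((K * a' + K * b') / 2) := by ring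
      _ ≤ Real.exp ((2 * p 0 - 1) ^ 2) * ((K * a' + K * b') / 2) := by gcongr
      _ = _ := by ring

/-- From 1 - ε ≤ e^(-ε) one gets u - v ≤ εu. The bound is linear in ε with no smallness assumption,
so the final theorem covers every ε > 0. -/
theorem abs_sub_le_mul_add_of_le_exp_mul {ε a b : ℝ} (ha : 0 ≤ a) (hb : 0 ≤ b) (hε : 0 ≤ ε)
    (hab : a ≤ Real.exp ε * b) (hba : b ≤ Real.exp ε * a) : |a - b| ≤ ε * (a + b) := by
  have key : ∀ u v : ℝ, 0 ≤ u → 0 ≤ v → u ≤ Real.exp ε * v → u - v ≤ ε * (u + v) := by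
    intro u v hu hv huv
    have h1 : Real.exp (-ε) * u ≤ v := by
      calc Real.exp (-ε) * u ≤ Real.exp (-ε) * (Real.exp ε * v) := by gcongr
        _ = v := by rw [← mul_assoc, ← Real.exp_add]; simp
    have h2 : (1 - ε) * u ≤ Real.exp (-ε) * u :=
      mul_le_mul_of_nonneg_right (by linarith [Real.add_one_le_exp (-ε)]) hu
    nlinarith [mul_nonneg hε hv]
  rw [abs_le]
  constructor <;> linarith [key a b ha hb hab, key b a hb ha hba]

/-- Change of measure from a product of Bernoulli laws to the uniform law, for functions that vary
by a factor of at most `exp ε` between neighbouring points of the cube. -/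
theorem bernoulliExp_le_of_hammingDist {n : ℕ} {p : Fin n → ℝ} {ε : ℝ} (hε : 0 ≤ ε)
    (hp : ∀ i, p i ∈ Set.Icc (0 : ℝ) 1) {f : (Fin n → Bool) → ℝ} (hf : ∀ y, 0 ≤ f y)
    (hdp : ∀ y y', hammingDist y y' = 1 → f y ≤ Real.exp ε * f y') :
    bernoulliExp p f ≤
      Real.exp (ε * ∑ i, |2 * p i - 1|) * bernoulliExp (fun _ => 1 / 2) f := by
  induction n with
  | zero => simp [bernoulliExp]
  | succ n ih =>
    rw [bernoulliExp_succ, bernoulliExp_succ, Fin.sum_univ_succ, mul_add ε, Real.exp_add]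
    have hcons : ∀ (b b' : Bool) (y y' : Fin n → Bool),
        hammingDist (Fin.cons b y : Fin (n + 1) → Bool) (Fin.cons b' y') =
          (if b = b' then 0 else 1) + hammingDist y y' := by
      intro b b' y y'
      simp only [hammingDist, Finset.card_filter, Fin.sum_univ_succ, Fin.cons_zero, Fin.cons_succ]
      congr 1
      split_ifs <;> simp_all
    have hsub : ∀ b : Bool, bernoulliExp (fun i => p i.succ) (fun y => f (Fin.cons b y)) ≤
        Real.exp (ε * ∑ i : Fin n, |2 * p i.succ - 1|) *
          bernoulliExp (fun _ => 1 / 2) (fun y => f (Fin.cons b y)) := fun b =>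
      ih (fun i => hp _) (fun y => hf _) fun y y' h => hdp _ _ (by rw [hcons]; simpa using h)
    have hswap : ∀ b b' : Bool, b ≠ b' →
        bernoulliExp (fun _ : Fin n => (1 / 2 : ℝ)) (fun y => f (Fin.cons b y)) ≤
        Real.exp ε * bernoulliExp (fun _ : Fin n => (1 / 2 : ℝ)) (fun y => f (Fin.cons b' y)) := by
      intro b b' hb
      rw [← bernoulliExp_const_mul]
      refine bernoulliExp_mono (fun _ => half_mem_Icc) fun y => hdp _ _ ?_
      rw [hcons]
      simp [hb]
    have hn : ∀ b : Bool,
        0 ≤ bernoulliExp (fun _ : Fin n => (1 / 2 : ℝ)) (fun y => f (Fin.cons b y)) := fun b =>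
      bernoulliExp_nonneg (fun _ => half_mem_Icc) fun y => hf _
    have hd := abs_sub_le_mul_add_of_le_exp_mul (hn true) (hn false) hε
      (hswap true false (by simp)) (hswap false true (by simp))
    have ht := hsub true
    have hff := hsub false
    have hnt := hn true
    have hnf := hn false
    set a := bernoulliExp (fun i => p i.succ) fun y => f (Fin.cons true y)
    set b := bernoulliExp (fun i => p i.succ) fun y => f (Fin.cons false y)
    set a' := bernoulliExp (fun _ : Fin n => (1 / 2 : ℝ)) fun y => f (Fin.cons true y)
    set b' := bernoulliExp (fun _ : Fin n => (1 / 2 : ℝ)) fun y => f (Fin.cons false y)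
    set K := Real.exp (ε * ∑ i : Fin n, |2 * p i.succ - 1|)
    have hK : 0 < K := Real.exp_pos _
    obtain ⟨hp0, hp1⟩ := hp 0
    have h3 : 1 + ε * |2 * p 0 - 1| ≤ Real.exp (ε * |2 * p 0 - 1|) := by
      linarith [Real.add_one_le_exp (ε * |2 * p 0 - 1|)]
    have h5 : (2 * p 0 - 1) * (a' - b') ≤ |2 * p 0 - 1| * (ε * (a' + b')) := by
      calc _ ≤ |(2 * p 0 - 1) * (a' - b')| := le_abs_self _
        _ = |2 * p 0 - 1| * |a' - b'| := abs_mul _ _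
        _ ≤ _ := by gcongr
    calc p 0 * a + (1 - p 0) * b ≤ p 0 * (K * a') + (1 - p 0) * (K * b') := by
          have : 0 ≤ 1 - p 0 := by linarith
          gcongr
      -- Mean plus bias times half-difference: privacy makes the difference at most ε times the sum,
      -- so only the bias |2p - 1| is paid for.
      _ = K * (((a' + b') + (2 * p 0 - 1) * (a' - b')) / 2) := by ring
      _ ≤ K * ((1 + ε * |2 * p 0 - 1|) * (a' + b') / 2) := by
          gcongr
          linarith
      _ ≤ K * (Real.exp (ε * |2 * p 0 - 1|) * (a' + b') / 2) := by gcongr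
      _ = _ := by ring

/-- For w ≥ 0, 1 - σ(w) = σ(w)e^(-w) ≥ σ(w)(1 - w), and σ(w) ≤ 1; negative arguments follow by
symmetry. This bounds a label's bias by its logit. -/
theorem abs_two_mul_sigmoid_sub_one_le (z : ℝ) : |2 * Real.sigmoid z - 1| ≤ |z| := by
  have key : ∀ w : ℝ, 0 ≤ w → 0 ≤ 2 * Real.sigmoid w - 1 ∧ 2 * Real.sigmoid w - 1 ≤ w := by
    intro w hw
    have h0 : Real.sigmoid 0 ≤ Real.sigmoid w := Real.sigmoid_le hw
    rw [Real.sigmoid_zero] at h0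
    refine ⟨by linarith, ?_⟩
    have h1 := Real.sigmoid_mul_rexp_neg w
    rw [Real.sigmoid_neg] at h1
    nlinarith [Real.add_one_le_exp (-w), Real.sigmoid_le_one w, Real.sigmoid_nonneg w]
  rcases le_total 0 z with hz | hz
  · rw [abs_of_nonneg hz, abs_of_nonneg (key z hz).1]
    exact (key z hz).2
  · have h := key (-z) (by linarith)
    rw [Real.sigmoid_neg] at h
    rw [abs_of_nonpos hz, abs_of_nonpos (by linarith [h.1])]
    linarith [h.2]

/-! ### Volumetric packing. -/

/-- A ball of radius `R` in a `k`-dimensional normed space contains `m ≤ (R / ρ) ^ k` points at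
pairwise distance at least `ρ`. -/
theorem exists_finset_separated {E : Type*} [NormedAddCommGroup E] [NormedSpace ℝ E]
    [FiniteDimensional ℝ E] [MeasurableSpace E] [BorelSpace E] {R ρ : ℝ} (hR : 0 < R) (hρ : 0 < ρ)
    (m : ℕ) (hm : (m : ℝ) ≤ (R / ρ) ^ Module.finrank ℝ E) :
    ∃ s : Finset E, s.card = m ∧ (∀ u ∈ s, ‖u‖ ≤ R) ∧
      ∀ u ∈ s, ∀ v ∈ s, u ≠ v → ρ ≤ dist u v := by
  classical
  induction m with
  | zero => exact ⟨∅, by simp⟩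
  | succ m ih =>
    push_cast at hm
    obtain ⟨s, hs, hsR, hsep⟩ := ih (by linarith)
    obtain ⟨w, hwR, hw⟩ : ∃ w : E, ‖w‖ ≤ R ∧ ∀ u ∈ s, ρ ≤ dist w u := by
      -- Otherwise the m balls of radius ρ cover the open ball of radius R, and comparing volumes
      -- gives (R/ρ)^k ≤ m.
      by_contra! hcon
      let μ : Measure E := Measure.addHaar
      have hsub : Metric.ball (0 : E) R ⊆ ⋃ u ∈ s, Metric.ball u ρ := by
        intro w hw
        obtain ⟨u, hu, hlt⟩ := hcon w (by simpa using (mem_ball_zero_iff.1 hw).le)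
        exact Set.mem_biUnion hu hlt
      have h1 : μ (Metric.ball (0 : E) R) ≤ ∑ u ∈ s, μ (Metric.ball u ρ) :=
        (measure_mono hsub).trans (measure_biUnion_finset_le _ _)
      simp_rw [μ, Measure.addHaar_ball_of_pos _ _ hρ, Measure.addHaar_ball_of_pos _ _ hR,
        Finset.sum_const, hs, nsmul_eq_mul, ← mul_assoc] at h1
      have hb0 : (Measure.addHaar : Measure E) (Metric.ball 0 1) ≠ 0 :=
        (Metric.measure_ball_pos _ _ one_pos).ne'
      have hbt : (Measure.addHaar : Measure E) (Metric.ball 0 1) ≠ ⊤ := measure_ball_lt_top.ne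
      rw [ENNReal.mul_le_mul_iff_left hb0 hbt, ← ENNReal.ofReal_natCast,
        ← ENNReal.ofReal_mul (by positivity), ENNReal.ofReal_le_ofReal_iff (by positivity)] at h1
      rw [div_pow, le_div_iff₀ (by positivity)] at hm
      nlinarith [pow_pos hρ (Module.finrank ℝ E)]
    have hws : w ∉ s := fun h => by
      have := hw w h
      simp at this
      linarith
    refine ⟨insert w s, by simp [hws, hs], ?_, ?_⟩
    · intro u hu
      rcases Finset.mem_insert.1 hu with rfl | hu
      exacts [hwR, hsR _ hu]
    · intro u hu v hv huv
      rcases Finset.mem_insert.1 hu with hu | hu <;> rcases Finset.mem_insert.1 hv with hv | hv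
      · exact absurd (hu.trans hv.symm) huv
      · rw [hu]; exact hw _ hv
      · rw [hv, dist_comm]; exact hw _ hu
      · exact hsep _ hu _ hv huv

/-! ### Geometry of the regularized covariance norm. -/

/-- A linear map into a Euclidean space whose squared norm is the quadratic form
`‖v‖²_{Σ_D + lam I}`. -/
noncomputable def regCovMap {n d : ℕ} (x : Fin n → EuclideanSpace ℝ (Fin d)) (lam : ℝ) :
    EuclideanSpace ℝ (Fin d) →ₗ[ℝ] EuclideanSpace ℝ (Fin n ⊕ Fin d) where
  toFun v := WithLp.toLp 2
    (Sum.elim (fun i => (√(n : ℝ))⁻¹ * inner ℝ (x i) v) fun j => √lam * v j)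
  map_add' u v := by
    ext i
    rcases i with i | i <;> simp [inner_add_right, mul_add]
  map_smul' a v := by
    ext i
    rcases i with i | i <;> simp [inner_smul_right] <;> ring

theorem norm_sq_regCovMap {n d : ℕ} (x : Fin n → EuclideanSpace ℝ (Fin d)) {lam : ℝ}
    (hlam : 0 ≤ lam) (v : EuclideanSpace ℝ (Fin d)) :
    ‖regCovMap x lam v‖ ^ 2 = (n : ℝ)⁻¹ * ∑ i, inner ℝ (x i) v ^ 2 + lam * ‖v‖ ^ 2 := by
  rw [EuclideanSpace.norm_sq_eq, EuclideanSpace.norm_sq_eq]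
  simp [regCovMap, mul_pow, Finset.mul_sum, Real.sq_sqrt hlam]

theorem sqSemiNorm_eq_norm_sq {n d : ℕ} (x : Fin n → EuclideanSpace ℝ (Fin d)) {lam : ℝ}
    (hlam : 0 ≤ lam) (v : EuclideanSpace ℝ (Fin d)) :
    sqSemiNorm (sampleCov x + lam • (1 : Matrix (Fin d) (Fin d) ℝ)) v =
      ‖regCovMap x lam v‖ ^ 2 := by
  rw [norm_sq_regCovMap x hlam, EuclideanSpace.norm_sq_eq]
  simp only [sqSemiNorm, sampleCov, Matrix.add_mulVec, Matrix.smul_mulVec, Matrix.one_mulVec,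
    dotProduct_add, dotProduct_smul, Matrix.sum_mulVec, dotProduct_sum, Matrix.vecMulVec_mulVec,
    smul_eq_mul, one_div]
  congr 2
  · refine Finset.sum_congr rfl fun i _ => ?_
    simp [PiLp.inner_apply, dotProduct, sq, mul_comm]
  · simp [dotProduct, sq]

theorem regCovMap_injective {n d : ℕ} (x : Fin n → EuclideanSpace ℝ (Fin d)) {lam : ℝ}
    (hlam : 0 < lam) : Function.Injective (regCovMap x lam) := by
  rw [injective_iff_map_eq_zero]
  intro v hv
  have h := norm_sq_regCovMap x hlam.le v
  rw [hv, norm_zero] at h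
  have h1 : 0 ≤ (n : ℝ)⁻¹ * ∑ i, inner ℝ (x i) v ^ 2 := by positivity
  have h2 : ‖v‖ ^ 2 ≤ 0 := by
    by_contra! h2
    nlinarith [mul_pos hlam h2]
  simpa using h2

theorem sum_inner_sq_le {n d : ℕ} (x : Fin n → EuclideanSpace ℝ (Fin d)) {lam : ℝ}
    (hlam : 0 ≤ lam) (v : EuclideanSpace ℝ (Fin d)) :
    ∑ i, inner ℝ (x i) v ^ 2 ≤ n * ‖regCovMap x lam v‖ ^ 2 := by
  rcases n.eq_zero_or_pos with rfl | hn
  · simp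
  have hn' : (0 : ℝ) < n := by exact_mod_cast hn
  rw [norm_sq_regCovMap x hlam, mul_add, mul_inv_cancel_left₀ hn'.ne']
  have : 0 ≤ (n : ℝ) * (lam * ‖v‖ ^ 2) := by positivity
  linarith

/-- Cauchy-Schwarz over the n samples; this controls the privacy cost, as `sum_inner_sq_le` controls
the second-moment cost. -/
theorem sum_abs_inner_le {n d : ℕ} (x : Fin n → EuclideanSpace ℝ (Fin d)) {lam : ℝ}
    (hlam : 0 ≤ lam) (v : EuclideanSpace ℝ (Fin d)) :
    ∑ i, |inner ℝ (x i) v| ≤ n * ‖regCovMap x lam v‖ := by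
  refine abs_le_of_sq_le_sq' ?_ (by positivity) |>.2
  calc (∑ i, |inner ℝ (x i) v|) ^ 2
      ≤ (Finset.univ : Finset (Fin n)).card * ∑ i, |inner ℝ (x i) v| ^ 2 := sq_sum_le_card_mul_sum_sq
    _ ≤ n * (n * ‖regCovMap x lam v‖ ^ 2) := by
        simp only [sq_abs, Finset.card_univ, Fintype.card_fin]
        gcongr
        exact sum_inner_sq_le x hlam v
    _ = _ := by ring

theorem norm_le_of_norm_regCovMap_le {n d : ℕ} (x : Fin n → EuclideanSpace ℝ (Fin d)) {lam B : ℝ}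
    (hlam : 0 < lam) (hB : 0 ≤ B) {v : EuclideanSpace ℝ (Fin d)}
    (hv : ‖regCovMap x lam v‖ ≤ √lam * B) : ‖v‖ ≤ B := by
  have h := norm_sq_regCovMap x hlam.le v
  have h1 : 0 ≤ (n : ℝ)⁻¹ * ∑ i, inner ℝ (x i) v ^ 2 := by positivity
  have h2 : ‖regCovMap x lam v‖ ^ 2 ≤ (√lam * B) ^ 2 := by gcongr
  rw [mul_pow, Real.sq_sqrt hlam.le] at h2
  have h3 : lam * ‖v‖ ^ 2 ≤ lam * B ^ 2 := by linarith
  exact abs_le_of_sq_le_sq' (le_of_mul_le_mul_left h3 hlam) hB |>.2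

theorem le_finrank_ker_sum (d : ℕ) (f : EuclideanSpace ℝ (Fin d) →ₗ[ℝ] ℝ) :
    d - 1 ≤ Module.finrank ℝ (LinearMap.ker f) := by
  have h := LinearMap.finrank_range_add_finrank_ker f
  have h1 : Module.finrank ℝ (LinearMap.range f) ≤ 1 :=
    (Submodule.finrank_le _).trans (by simp)
  rw [finrank_euclideanSpace_fin] at h
  omega

/-- Packing of the centred parameters in the norm `‖·‖_{Σ_D + lam I}`. -/
theorem exists_parameter_packing {n d : ℕ} (x : Fin n → EuclideanSpace ℝ (Fin d)) {lam R : ℝ}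
    (hlam : 0 < lam) (hR : 0 < R) :
    ∃ θ : Fin (16 ^ (d - 1)) → EuclideanSpace ℝ (Fin d),
      (∀ i, ∑ j, θ i j = 0) ∧ (∀ i, ‖regCovMap x lam (θ i)‖ ≤ R) ∧
      ∀ i j, i ≠ j → R / 16 ≤ dist (regCovMap x lam (θ i)) (regCovMap x lam (θ j)) := by
  let f : EuclideanSpace ℝ (Fin d) →ₗ[ℝ] ℝ :=
    { toFun := fun v => ∑ j, v j
      map_add' := fun u v => by simp [Finset.sum_add_distrib]
      map_smul' := fun a v => by simp [Finset.mul_sum] }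
  -- Packing the image makes the separation hold in the loss norm; injectivity preserves the
  -- dimension, so centring costs at most one.
  let T := (LinearMap.ker f).map (regCovMap x lam)
  have hT : d - 1 ≤ Module.finrank ℝ T := by
    rw [(Submodule.equivMapOfInjective _ (regCovMap_injective x hlam) _).symm.finrank_eq]
    exact le_finrank_ker_sum d f
  have hm : ((16 ^ (d - 1) : ℕ) : ℝ) ≤ (R / (R / 16)) ^ Module.finrank ℝ T := by
    rw [div_div_cancel₀ hR.ne']
    push_cast
    exact pow_le_pow_right₀ (by norm_num) hT
  obtain ⟨s, hs, hsR, hsep⟩ := exists_finset_separated (E := T) hR (by positivity) _ hm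
  let e := s.equivFinOfCardEq hs
  have hpre : ∀ u : T, ∃ v, v ∈ LinearMap.ker f ∧ regCovMap x lam v = u := fun u => by
    obtain ⟨v, hv, hvu⟩ := u.2
    exact ⟨v, hv, hvu⟩
  choose g hg hgu using hpre
  refine ⟨fun i => g (e.symm i), fun i => hg _, fun i => ?_, fun i j hij => ?_⟩
  · rw [hgu]
    exact hsR _ (e.symm i).2
  · rw [hgu, hgu]
    exact hsep _ (e.symm i).2 _ (e.symm j).2 fun h => hij (e.symm.injective (Subtype.ext h))

/-! ### From risk to hitting probabilities. -/

theorem lintegral_btlLaw {n d : ℕ} (x : Fin n → EuclideanSpace ℝ (Fin d))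
    (θ : EuclideanSpace ℝ (Fin d)) {f : (Fin n → Bool) → ℝ} (hf : ∀ y, 0 ≤ f y) :
    ∫⁻ y, ENNReal.ofReal (f y) ∂(btlLaw x θ) =
      ENNReal.ofReal (bernoulliExp (fun i => Real.sigmoid (inner ℝ (x i) θ)) f) := by
  have hw : ∀ (y : Fin n → Bool) (i : Fin n), 0 ≤ if y i then Real.sigmoid (inner ℝ (x i) θ) else
      1 - Real.sigmoid (inner ℝ (x i) θ) := by
    intro y i
    split_ifs
    · exact Real.sigmoid_nonneg _
    · linarith [Real.sigmoid_le_one (inner ℝ (x i) θ)]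
  rw [lintegral_fintype, bernoulliExp, ENNReal.ofReal_sum_of_nonneg fun y _ =>
    mul_nonneg (Finset.prod_nonneg fun i _ => hw y i) (hf y)]
  refine Finset.sum_congr rfl fun y _ => ?_
  rw [ENNReal.ofReal_mul (Finset.prod_nonneg fun i _ => hw y i), mul_comm,
    ENNReal.ofReal_prod_of_nonneg fun i _ => hw y i, btlLaw, Measure.pi_singleton]
  congr 1
  refine Finset.prod_congr rfl fun i _ => ?_
  rw [← ENNReal.ofReal_toReal (measure_ne_top (bernoulliMeasure true false _) {y i}),
    ← measureReal_def]
  rcases hy : y i <;> simp [unitInterval.sigmoid, Subtype.coind]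

/-- Markov's inequality: an estimator with small risk at `θ` is close to `θ` with probability at
least one half. -/
theorem half_le_bernoulliExp_of_risk_lt {n d : ℕ} (x : Fin n → EuclideanSpace ℝ (Fin d)) {lam r : ℝ}
    (hlam : 0 ≤ lam) (hr : 0 < r) (M : Kernel (Fin n → Bool) (EuclideanSpace ℝ (Fin d)))
    [IsMarkovKernel M] (θ : EuclideanSpace ℝ (Fin d))
    (hrisk : semiNormRisk x lam M θ < ENNReal.ofReal (r ^ 2 / 2)) :
    1 / 2 ≤ bernoulliExp (fun i => Real.sigmoid (inner ℝ (x i) θ))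
      (fun y => (M y).real (regCovMap x lam ⁻¹' Metric.ball (regCovMap x lam θ) r)) := by
  set S := regCovMap x lam ⁻¹' Metric.ball (regCovMap x lam θ) r with hS
  have hcont : Continuous (regCovMap x lam) := LinearMap.continuous_of_finiteDimensional _
  have hSm : MeasurableSet S := (Metric.isOpen_ball.preimage hcont).measurableSet
  have hle : ∀ y, ENNReal.ofReal (r ^ 2 * (1 - (M y).real S)) ≤ ∫⁻ t, ENNReal.ofReal
      (sqSemiNorm (sampleCov x + lam • (1 : Matrix (Fin d) (Fin d) ℝ)) (t - θ)) ∂(M y) := by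
    intro y
    simp_rw [sqSemiNorm_eq_norm_sq x hlam]
    refine le_trans (le_of_eq ?_) ((mul_le_mul_right (measure_mono (μ := M y) (s := Sᶜ) ?_) _).trans
      (mul_meas_ge_le_lintegral (by fun_prop) (ENNReal.ofReal (r ^ 2))))
    · rw [ENNReal.ofReal_mul (by positivity), ← probReal_compl_eq_one_sub hSm, ofReal_measureReal]
    · intro t ht
      simp only [hS, Set.mem_compl_iff, Set.mem_preimage, Metric.mem_ball, not_lt,
        dist_eq_norm, ← map_sub] at ht
      exact ENNReal.ofReal_le_ofReal (by gcongr)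
  have h1 : ENNReal.ofReal (bernoulliExp (fun i => Real.sigmoid (inner ℝ (x i) θ))
      (fun y => r ^ 2 * (1 - (M y).real S))) < ENNReal.ofReal (r ^ 2 / 2) := by
    rw [← lintegral_btlLaw x θ fun y => mul_nonneg (by positivity)
      (by linarith [measureReal_le_one (μ := M y) (s := S)])]
    exact (lintegral_mono hle).trans_lt hrisk
  rw [ENNReal.ofReal_lt_ofReal_iff (by positivity), bernoulliExp_const_mul] at h1
  -- Additivity over `Bool` encodes that the hit and miss probabilities sum to one.
  have h2 := bernoulliExp_sum (fun i => Real.sigmoid (inner ℝ (x i) θ))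
    (fun b : Bool => fun y => if b then (M y).real S else 1 - (M y).real S)
  simp only [Fintype.sum_bool, if_true, Bool.false_eq_true, if_false, add_sub_cancel,
    bernoulliExp_one] at h2
  nlinarith [pow_pos hr 2]

/-! ### Packing contradiction at a fixed scale. -/

theorem exp_natCast_mul_four_lt {k : ℕ} (hk : 1 ≤ k) : Real.exp k * 4 < 16 ^ k := by
  have h1 : Real.exp k < 4 ^ k := by
    rw [← Real.exp_one_rpow, Real.rpow_natCast]
    exact pow_lt_pow_left₀ (by linarith [Real.exp_one_lt_d9]) (Real.exp_pos _).le (by omega)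
  have h2 : (4 : ℝ) ≤ 4 ^ k := le_self_pow₀ (by norm_num) (by omega)
  have h3 : (16 : ℝ) ^ k = 4 ^ k * 4 ^ k := by rw [← mul_pow]; norm_num
  rw [h3]
  nlinarith [Real.exp_pos k]

/-- Minimax lower bound at a single scale `R`: the scale is admissible if it is too small for the
labels to be informative, or too small for a differentially private mechanism to use them. -/
theorem exists_risk_ge {n d : ℕ} (x : Fin n → EuclideanSpace ℝ (Fin d)) {B lam ε R : ℝ}
    (hd : 2 ≤ d) (hB : 0 ≤ B) (hlam : 0 < lam) (hε : 0 ≤ ε) (hR : 0 < R) (hRB : R ≤ √lam * B)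
    (M : Kernel (Fin n → Bool) (EuclideanSpace ℝ (Fin d))) [IsMarkovKernel M]
    (hM : IsCentralLabelDP ε 0 M)
    (hscale : n * R ^ 2 ≤ (d - 1 : ℕ) ∨ ε * (n * R) ≤ (d - 1 : ℕ)) :
    ∃ θ ∈ paramSet d B, ENNReal.ofReal ((R / 32) ^ 2 / 2) ≤ semiNormRisk x lam M θ := by
  obtain ⟨θ, hsum, hnorm, hsep⟩ := exists_parameter_packing x hlam hR
  by_contra! hcon
  have hmem : ∀ i, θ i ∈ paramSet d B := fun i =>
    ⟨hsum i, norm_le_of_norm_regCovMap_le x hlam hB ((hnorm i).trans hRB)⟩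
  have hcont : Continuous (regCovMap x lam) := LinearMap.continuous_of_finiteDimensional _
  let S := fun i => regCovMap x lam ⁻¹' Metric.ball (regCovMap x lam (θ i)) (R / 32)
  have hS : ∀ i, MeasurableSet (S i) := fun i =>
    (Metric.isOpen_ball.preimage hcont).measurableSet
  let f := fun i y => (M y).real (S i)
  have hf0 : ∀ i y, 0 ≤ f i y := fun i y => measureReal_nonneg
  have hf1 : ∀ i y, f i y ≤ 1 := fun i y => measureReal_le_one
  let p := fun i j => Real.sigmoid (inner ℝ (x j) (θ i))
  have hp : ∀ i j, p i j ∈ Set.Icc (0 : ℝ) 1 := fun i j =>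
    ⟨Real.sigmoid_nonneg _, Real.sigmoid_le_one _⟩
  have hhalf : ∀ i, 1 / 2 ≤ bernoulliExp (p i) (f i) := fun i =>
    half_le_bernoulliExp_of_risk_lt x hlam.le (by positivity) M (θ i) (hcon _ (hmem i))
  have hdisj : Pairwise (Function.onFun Disjoint S) := fun i j hij =>
    Disjoint.preimage _ (Metric.ball_disjoint_ball (by linarith [hsep i j hij]))
  have htot : ∑ i, bernoulliExp (fun _ => 1 / 2) (f i) ≤ 1 := by
    rw [bernoulliExp_sum]
    refine le_of_le_of_eq ?_ (bernoulliExp_one (n := n) fun _ => 1 / 2)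
    refine bernoulliExp_mono (fun _ => half_mem_Icc) fun y => ?_
    rw [← measureReal_iUnion_fintype hdisj hS]
    exact measureReal_le_one
  -- The 1/4 is (1/2)² from the second-moment route; the privacy route would give 1/2.
  have hlow : ∀ i, 1 / 4 ≤ Real.exp (d - 1 : ℕ) * bernoulliExp (fun _ => 1 / 2) (f i) := by
    intro i
    have hE : 0 ≤ bernoulliExp (fun _ => 1 / 2) (f i) :=
      bernoulliExp_nonneg (fun _ => half_mem_Icc) (hf0 i)
    have habs : ∀ j, |2 * p i j - 1| ≤ |inner ℝ (x j) (θ i)| := fun j =>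
      abs_two_mul_sigmoid_sub_one_le _
    rcases hscale with h | h
    · have hexp : ∑ j, (2 * p i j - 1) ^ 2 ≤ ((d - 1 : ℕ) : ℝ) :=
        calc ∑ j, (2 * p i j - 1) ^ 2 ≤ ∑ j, inner ℝ (x j) (θ i) ^ 2 :=
              Finset.sum_le_sum fun j _ => sq_le_sq.2 (habs j)
          _ ≤ n * ‖regCovMap x lam (θ i)‖ ^ 2 := sum_inner_sq_le x hlam.le _
          _ ≤ n * R ^ 2 := by gcongr; exact hnorm i
          _ ≤ _ := h
      -- Hitting probabilities lie in [0, 1], so the second moment is at most the mean.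
      have hsq : bernoulliExp (fun _ => 1 / 2) (fun y => f i y ^ 2) ≤
          bernoulliExp (fun _ => 1 / 2) (f i) :=
        bernoulliExp_mono (fun _ => half_mem_Icc) fun y => by nlinarith [hf0 i y, hf1 i y]
      calc (1 / 4 : ℝ) = (1 / 2) ^ 2 := by norm_num
        _ ≤ bernoulliExp (p i) (f i) ^ 2 := by gcongr; exact hhalf i
        _ ≤ _ := sq_bernoulliExp_le _
        _ ≤ Real.exp (∑ j, (2 * p i j - 1) ^ 2) * bernoulliExp (fun _ => 1 / 2) (f i) := by gcongr
        _ ≤ _ := by gcongr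
    · have hexp : ε * ∑ j, |2 * p i j - 1| ≤ ((d - 1 : ℕ) : ℝ) :=
        calc ε * ∑ j, |2 * p i j - 1| ≤ ε * ∑ j, |inner ℝ (x j) (θ i)| := by
              exact mul_le_mul_of_nonneg_left (Finset.sum_le_sum fun j _ => habs j) hε
          _ ≤ ε * (n * ‖regCovMap x lam (θ i)‖) := by gcongr; exact sum_abs_inner_le x hlam.le _
          _ ≤ ε * (n * R) := by gcongr; exact hnorm i
          _ ≤ _ := h
      have hdp : ∀ y y', hammingDist y y' = 1 → f i y ≤ Real.exp ε * f i y' := by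
        intro y y' hyy
        have h1 := hM y y' hyy (S i) (hS i)
        rw [ENNReal.ofReal_zero, add_zero] at h1
        have h2 := ENNReal.toReal_mono
          (ENNReal.mul_ne_top ENNReal.ofReal_ne_top (measure_ne_top _ _)) h1
        rwa [ENNReal.toReal_mul, ENNReal.toReal_ofReal (Real.exp_pos ε).le] at h2
      calc (1 / 4 : ℝ) ≤ 1 / 2 := by norm_num
        _ ≤ bernoulliExp (p i) (f i) := hhalf i
        _ ≤ _ := bernoulliExp_le_of_hammingDist hε (hp i) (hf0 i) hdp
        _ ≤ _ := by gcongr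
  have hfin := Finset.sum_le_sum fun i (_ : i ∈ Finset.univ) => hlow i
  rw [← Finset.mul_sum, Finset.sum_const, Finset.card_univ, Fintype.card_fin, nsmul_eq_mul] at hfin
  push_cast at hfin
  have hk := exp_natCast_mul_four_lt (k := d - 1) (by omega)
  nlinarith [Real.exp_pos (d - 1 : ℕ)]

/-! ### Choice of the scale. -/

theorem mainTheorem10 :
    ∃ c C : ℝ, 0 < c ∧ 0 < C ∧
      ∀ (d n : ℕ) (B lam ε : ℝ), 2 ≤ d → 0 < B → 0 < lam → 0 < ε →
        C * d / (lam * B ^ 2) ≤ n →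
        C * d / (ε * B * Real.sqrt lam) ≤ n →
        ∀ (x : Fin n → EuclideanSpace ℝ (Fin d))
          (M : Kernel (Fin n → Bool) (EuclideanSpace ℝ (Fin d))),
          IsMarkovKernel M → IsCentralLabelDP ε 0 M →
          ∃ θ ∈ paramSet d B,
            ENNReal.ofReal (c * ((d : ℝ) / n + (d : ℝ) ^ 2 / ((n : ℝ) ^ 2 * ε ^ 2)))
              ≤ semiNormRisk x lam M θ := by
  -- 16384 = 2048 · 8: (R/32)²/2 = R²/2048, while the target rate is at most 4 · 2R², by d ≤ 2(d -
  -- 1) and the choice of R.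
  refine ⟨1 / 16384, 1, by norm_num, by norm_num, ?_⟩
  intro d n B lam ε hd hB hlam hε h1 h2 x M _ hM
  have hd0 : (2 : ℝ) ≤ d := by exact_mod_cast hd
  have hs : 0 < √lam := Real.sqrt_pos.2 hlam
  have hn : (0 : ℝ) < n := lt_of_lt_of_le (by positivity) h1
  rw [one_mul, div_le_iff₀ (by positivity)] at h1 h2
  set k : ℝ := ((d - 1 : ℕ) : ℝ) with hk
  have hkd : k = d - 1 := by rw [hk, Nat.cast_sub (by omega)]; simp
  have hk0 : 0 < k := by linarith
  have ha0 : 0 < k / n := by positivity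
  have hb0 : 0 < k / (n * ε) := by positivity
  have hdk : (d : ℝ) ≤ 2 * k := by linarith
  have hbound : (d : ℝ) / n + (d : ℝ) ^ 2 / ((n : ℝ) ^ 2 * ε ^ 2) ≤
      4 * (k / n + (k / (n * ε)) ^ 2) := by
    have e1 : (d : ℝ) / n ≤ 2 * k / n := by gcongr
    have e2 : (d : ℝ) ^ 2 / ((n : ℝ) ^ 2 * ε ^ 2) ≤ (2 * k) ^ 2 / ((n : ℝ) ^ 2 * ε ^ 2) := by gcongr
    have e3 : (2 * k) ^ 2 / ((n : ℝ) ^ 2 * ε ^ 2) = 4 * (k / (n * ε)) ^ 2 := by ring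
    have e4 : 2 * k / n = 2 * (k / n) := by ring
    linarith
  have hfinish : ∀ R : ℝ, 0 < R → R ≤ √lam * B → k / n + (k / (n * ε)) ^ 2 ≤ 2 * R ^ 2 →
      (n * R ^ 2 ≤ k ∨ ε * (n * R) ≤ k) →
      ∃ θ ∈ paramSet d B,
        ENNReal.ofReal (1 / 16384 * ((d : ℝ) / n + (d : ℝ) ^ 2 / ((n : ℝ) ^ 2 * ε ^ 2)))
          ≤ semiNormRisk x lam M θ := by
    intro R hR hRB hR2 hscale
    obtain ⟨θ, hθ, hrisk⟩ := exists_risk_ge x hd hB.le hlam hε.le hR hRB M hM hscale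
    refine ⟨θ, hθ, (ENNReal.ofReal_le_ofReal ?_).trans hrisk⟩
    linarith
  have hsq : √(k / n) ^ 2 = k / n := Real.sq_sqrt ha0.le
  -- R² is the larger of the two rates, hence at least half their sum. The two sample-size
  -- hypotheses give R ≤ √lam * B in the respective cases.
  rcases le_total ((k / (n * ε)) ^ 2) (k / n) with hle | hle
  · refine hfinish √(k / n) (Real.sqrt_pos.2 ha0) ?_ (by rw [hsq]; linarith) (Or.inl ?_)
    · rw [Real.sqrt_le_left (by positivity), mul_pow, Real.sq_sqrt hlam.le,
        div_le_iff₀ hn]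
      linarith
    · rw [hsq, mul_div_cancel₀ _ hn.ne']
  · refine hfinish (k / (n * ε)) hb0 ?_ (by linarith) (Or.inr ?_)
    · rw [div_le_iff₀ (by positivity)]
      linarith
    · apply le_of_eq
      field_simp
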